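/- **Theorem.** For $k,m\ge 1$ write $s_k=(k+2,\underbrace{2,\dots,2}_{k-1})$ (a *singular sequence*) and $r_m=(\underbrace{2,\dots,2}_{m})$ (a *regular sequence*). Let $N\ge 1$, $0\le\rho\le N$, and let $\sigma=\sigma_0\sigma_1\cdots\sigma_{N+\rho-1}=(a_0,\dots,a_{n-1})$ be a concatenation of $N$ singular sequences $\sigma_{i_j}=s_{k_j}$, $0\le j\le N-1$, $i_0<i_1<\dots<i_{N-1}$, $k_j\ge1$, and $\rho$ regular sequences of lengths $\geq 1$, such that no two regular sequences are adjacent (indices of the $\sigma_i$ modulo $N+\rho$). *The matrix.* $M(\sigma)=(m_{ij})_{0\le i,j\le n-1}$ is the symmetric integer matrix with, all congruences being modulo $n$: $m_{ii}=a_i-2$ if $i\equiv i+a_i-1$ and $m_{ii}=a_i$ otherwise (for $n\ge 2$, the first case occurs exactly when $a_i=n+1$, and then $m_{ii}=n-1$); and for $i\neq j$, $m_{ij}=-2$ if both $j\equiv i+a_i-1$ and $i\equiv j+a_j-1$, $m_{ij}=-1$ if exactly one of these two congruences holds, and $m_{ij}=0$ otherwise. *The polynomials.* Let $A\subset\mathbb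 Z/N\mathbb Z$. A proper subset $B\subsetneq\mathbb Z/N\mathbb Z$ is *generating allowed* relatively to $A$ if $B=\{a\}$ with $a\in A$, or $B=\{k,k+1\}$ with $k\notin A$ (that is, $k,k+1$ are consecutive in one of the arcs obtained by cutting the circle $\mathbb Z/N\mathbb Z$ between $a$ and $a+1$ for every $a\in A$). A proper subset $B\subsetneq\mathbb Z/N\mathbb Z$ is *allowed* if it has a (possibly empty) partition into generating allowed subsets. Put $$P_A(X_0,\dots,X_{N-1})=\sum_{B\ \text{allowed}}\ \prod_{i\notin B}X_i\in\mathbb Z[X_0,\dots,X_{N-1}].$$ Let $A(\sigma)\subset\mathbb Z/N\mathbb Z$ be the set of those $j$ for which $\sigma_{i_j+1}$ (index modulo $N+\rho$) is a regular sequence. Then $$\det M(\sigma)=P_{A(\sigma)}(k_0,\dots,k_{N-1})^2 .$$ In particular, the determinant does not depend on the lengths of the regular sequences: if $\sigma'$ is obtained from $\sigma$ by replacing each regular sequence with a regular sequence of any length $\geq 1$, then $\det M(\sigma')=\det M(\sigma)$. -/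

import Mathlib

/-! Sequences made of singular and regular blocks, the matrix "written on a torus" attached to a
sequence of integers, and the polynomials `P_A`. The cyclic group `ℤ/nℤ` is represented by
`Fin n`; its translation `i ↦ i + 1` (modulo `n`) is Mathlib's `finRotate n`. -/

namespace GSS

/-- A block of a sequence: a singular sequence `s_k` or a regular sequence `r_m`. -/
inductive Block where
  | singular (k : ℕ) : Block
  | regular (m : ℕ) : Block

/-- The integers of a block, for positive lengths: `s_k = (k+2, 2, …, 2)` with `k` terms and
`r_m = (2, …, 2)` with `m` terms. -/
def Block.toList : Block → List ℕ
  | .singular k => (k + 2) :: List.replicate (k - 1) 2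
  | .regular m => List.replicate m 2

/-- The block is a regular sequence. -/
def Block.IsRegular : Block → Prop
  | .singular _ => False
  | .regular _ => True

/-- The sequence of integers `(a_0, …, a_{n-1}) = σ_0 σ_1 ⋯ σ_{L-1}` (concatenation). -/
def concat {L : ℕ} (σ : Fin L → Block) : List ℕ :=
  (List.ofFn σ).flatMap Block.toList

/-- `j = i + a_i - 1` modulo `n`, where `n` is the number of terms of `a`. -/
def Meets (a : List ℕ) (i j : Fin a.length) : Prop :=
  (i : ℕ) + a.get i ≡ (j : ℕ) + 1 [MOD a.length]

instance (a : List ℕ) (i j : Fin a.length) : Decidable (Meets a i j) :=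
  inferInstanceAs (Decidable ((i : ℕ) + a.get i ≡ (j : ℕ) + 1 [MOD a.length]))

/-- The symmetric matrix `M(a)` of the sequence `a = (a_0, …, a_{n-1})`, indices modulo `n`.
A diagonal entry is `a_i`, lowered to `a_i - 2` if `i = i + a_i - 1` modulo `n`, that is, if the
`i`-th curve has a double point. For the sequences `a` made of singular and regular blocks and
`n ≥ 2` this happens exactly if `a_i = n + 1`, and then the entry is `n - 1`. -/
def intersectionMatrix (a : List ℕ) : Matrix (Fin a.length) (Fin a.length) ℤ :=
  Matrix.of fun i j =>
    if i = j then
      if Meets a i i then (a.get i : ℤ) - 2 else (a.get i : ℤ)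
    else if Meets a i j ∧ Meets a j i then -2
    else if Meets a i j ∨ Meets a j i then -1
    else 0

/-- `M(σ)` for a sequence `σ` of blocks. -/
def M {L : ℕ} (σ : Fin L → Block) :
    Matrix (Fin (concat σ).length) (Fin (concat σ).length) ℤ :=
  intersectionMatrix (concat σ)

/-- Generating allowed subsets relatively to `A ⊆ ℤ/Nℤ`: the proper subsets of the form `{a}` with
`a ∈ A`, or `{k, k+1}` with `k`, `k+1` consecutive in one of the arcs obtained by cutting the
circle `ℤ/Nℤ` between `a` and `a + 1` for each `a ∈ A`. As `k` and `k+1` are separated exactly by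
a cut between them, the latter condition is `k ∉ A`. -/
def IsGenerating {N : ℕ} (A B : Finset (Fin N)) : Prop :=
  B ≠ Finset.univ ∧
    ((∃ a ∈ A, B = {a}) ∨ ∃ k, k ∉ A ∧ B = {k, finRotate N k})

/-- Allowed subsets relatively to `A`: the proper subsets with a (possibly empty) partition into
generating allowed subsets. -/
def IsAllowed {N : ℕ} (A B : Finset (Fin N)) : Prop :=
  B ≠ Finset.univ ∧ ∃ Q : Finpartition B, ∀ G ∈ Q.parts, IsGenerating A G

open Classical in
/-- The polynomial `P_A = ∑_B ∏_{i ∉ B} X_i`, the sum over all allowed subsets `B`. -/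
noncomputable def P {N : ℕ} (A : Finset (Fin N)) : MvPolynomial (Fin N) ℤ :=
  ∑ B ∈ Finset.univ.filter (fun B : Finset (Fin N) => IsAllowed A B),
    ∏ i ∈ Bᶜ, MvPolynomial.X i

open Classical in
/-- The set `A(σ)` of the `j` such that the `j`-th singular sequence `σ_{pos j}` is followed,
cyclically, by a regular sequence. -/
noncomputable def followSet {N L : ℕ} (σ : Fin L → Block) (pos : Fin N → Fin L) :
    Finset (Fin N) :=
  Finset.univ.filter fun j => (σ (finRotate L (pos j))).IsRegular

/-- The sequence `σ = σ_0 ⋯ σ_{L-1}` consists of the singular sequences `σ_{pos j} = s_{k_j}` with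
`k_j ≥ 1`, where `pos 0 < pos 1 < ⋯ < pos (N-1)`, and of regular sequences of positive lengths at
all other places, no two regular sequences being cyclically adjacent. -/
structure IsDecomposition {N L : ℕ} (σ : Fin L → Block) (pos : Fin N → Fin L) (k : Fin N → ℕ) :
    Prop where
  strictMono : StrictMono pos
  one_le : ∀ j, 1 ≤ k j
  singular : ∀ j, σ (pos j) = Block.singular (k j)
  regular : ∀ t, t ∉ Set.range pos → ∃ m, 1 ≤ m ∧ σ t = Block.regular m
  not_adjacent : ∀ t, (σ t).IsRegular → ¬ (σ (finRotate L t)).IsRegular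

end GSS

/-!
The matrix `M(σ)` is a Gram matrix. Let `C` be the square matrix with rows
`e_i - e_{i+1} - ⋯ - e_{i+a_i-1}`, indices modulo `n`. Each entry `a_i > 2` is `k + 2` and is followed
by `k - 1` entries `2`, whence `M(σ) = C Cᵀ` (`intersectionMatrix_eq`,
`curveMatrix_mul_transpose_apply`) and `det M(σ) = (det C)²`.

A row of `C` with `a_i = 2` is `e_i - e_{i+1}`. These rows serve to identify all coordinates between
two consecutive starts of singular blocks with the coordinate of the second start. What remains is an
`N × N` matrix with rows `e_j - k_j e_{j+1} - e_{skip j}`, where `skip j` is `j + 1` or `j + 2`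
according as `j ∈ A(σ)` or not (`IsNecklace.det_curveMatrix`); the lengths of the regular blocks have
disappeared.

The determinant of the negative of this matrix is affine in each `k_j`. The coefficient of
`∏_{j ∉ B} k_j` is the determinant of the matrix with rows `e_{skip j} - e_j` for `j ∈ B` and `e_{j+1}`
for `j ∉ B`. For `B` the whole circle it vanishes. For a proper subset `B`, let `j` be the first
element of an arc of `B`. In a partition of `B` into generating allowed subsets, the part of `j` is
forced: it is `{j}` if `j ∈ A`, and `{j, j + 1}` otherwise. Row operations show that removing this part
from `B` does not change the determinant, and that the determinant vanishes if `j ∉ A` and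
`j + 1 ∉ B`. Hence the coefficient is the one of the empty set, a common sign, if `B` is allowed, and
zero otherwise (`det_coeffMatrix`).
-/

namespace GSS

open Finset

/-! ### The Gram matrix of paths on a cycle -/

section Gram
variable {ι : Type*}

theorem pow_apply_eq_pow_apply_of_le (τ : Equiv.Perm ι) {r s : ℕ} (h : r ≤ s) (i j : ι) :
    (τ ^ r) i = (τ ^ s) j ↔ i = (τ ^ (s - r)) j := by
  obtain ⟨x, rfl⟩ := Nat.exists_eq_add_of_le h
  simp [pow_add]

variable [DecidableEq ι]

/-- The matrix whose `i`-th row is `e_i - (e_{τ i} + ⋯ + e_{τ^{b i} i})`. A coordinate reached several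
times on the way from `τ i` to `τ^{b i} i` is subtracted with its multiplicity, so that no assumption
on the length of the cycles of `τ` is needed. -/
def curveMatrix (τ : Equiv.Perm ι) (b : ι → ℕ) : Matrix ι ι ℤ :=
  Matrix.of fun i l =>
    (if i = l then 1 else 0) - ∑ r ∈ range (b i), if (τ ^ (r + 1)) i = l then 1 else 0

/-- The inner product of the rows `j` and `i` if the latter is `e_i - e_{τ i}`: the sum over the row `j`
telescopes. -/
theorem gram_of_eq_one (τ : Equiv.Perm ι) (b : ι → ℕ) (i j : ι) (hi : b i = 1) :
    curveMatrix τ b j i - ∑ r ∈ range (b i), curveMatrix τ b j ((τ ^ (r + 1)) i) =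
      (if i = j then (b i : ℤ) + 1 else 0) - (if (τ ^ b i) i = j then 1 else 0) -
        if (τ ^ b j) j = i then 1 else 0 := by
  have key : ∑ s ∈ range (b j), (((if (τ ^ s) j = i then 1 else 0) : ℤ) -
      if (τ ^ (s + 1)) j = i then 1 else 0) = (if j = i then 1 else 0) -
        if (τ ^ b j) j = i then 1 else 0 := by
    rw [sum_range_sub' (fun s => ((if (τ ^ s) j = i then 1 else 0) : ℤ))]
    simp
  have h2 : ∀ s, (τ ^ (s + 1)) j = τ i ↔ (τ ^ s) j = i := fun s => by
    rw [pow_succ']; simp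
  rw [sum_sub_distrib] at key
  simp only [hi, sum_range_one, curveMatrix, Matrix.of_apply, zero_add, pow_one, h2,
    eq_comm (a := i) (b := j), eq_comm (a := τ i) (b := j)]
  by_cases hij : j = i <;> simp only [hij, if_true, if_false] at key ⊢ <;>
    push_cast [-Equiv.Perm.coe_pow] <;> linarith

/-- On the way from `j` to `τ^{b j} j`, a point `i` with `1 < b i` can only be one of the last two. -/
theorem sum_pow_apply_eq (τ : Equiv.Perm ι) (b : ι → ℕ)
    (hb : ∀ i x, 0 < x → x + 1 < b i → b ((τ ^ x) i) = 1) (i j : ι) (hi : 1 < b i) (hj : 1 < b j) :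
    ∑ s ∈ range (b j), ((if (τ ^ (s + 1)) j = i then 1 else 0) : ℤ) =
      (if (τ ^ (b j - 1)) j = i then 1 else 0) + if (τ ^ b j) j = i then 1 else 0 := by
  obtain ⟨m, hm⟩ := Nat.exists_eq_add_of_le hj
  rw [show b j = m + 1 + 1 by omega, sum_range_succ, sum_range_succ, sum_eq_zero]
  · simp
  · intro s hs
    rw [mem_range] at hs
    refine if_neg fun h => ?_
    have := hb j (s + 1) (by omega) (by omega)
    rw [h] at this
    omega

/-- The coincidences between the points `τ^{s+1} j` and `τ^{r+1} i` of two rows with more than two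
terms: apart from those with `r = s`, the last point before the end of one path may be the origin of
the other path. -/
theorem sum_sum_pow_apply_eq (τ : Equiv.Perm ι) (b : ι → ℕ)
    (hb : ∀ i x, 0 < x → x + 1 < b i → b ((τ ^ x) i) = 1) (i j : ι) (hi : 1 < b i) (hj : 1 < b j) :
    ∑ r ∈ range (b i), ∑ s ∈ range (b j),
        ((if (τ ^ (s + 1)) j = (τ ^ (r + 1)) i then 1 else 0) : ℤ) =
      (if i = j then (b i : ℤ) else 0) + (if (τ ^ (b i - 1)) i = j then 1 else 0) +
        if (τ ^ (b j - 1)) j = i then 1 else 0 := by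
  have aux : ∀ i j : ι, 1 < b i → 1 < b j → ∀ r s, r < s → s < b j →
      ((τ ^ (s + 1)) j = (τ ^ (r + 1)) i ↔ (r = 0 ∧ s = b j - 1) ∧ (τ ^ (b j - 1)) j = i) := by
    intro i j hi hj r s hrs hs
    rw [eq_comm, pow_apply_eq_pow_apply_of_le τ (by omega), eq_comm]
    constructor
    · intro h
      have hx : s + 1 - (r + 1) = b j - 1 := by
        by_contra hne
        have := hb j (s + 1 - (r + 1)) (by omega) (by omega)
        rw [h] at this
        omega
      rw [hx] at h
      exact ⟨by omega, h⟩
    · rintro ⟨⟨rfl, rfl⟩, h⟩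
      simpa using h
  have pt : ∀ r ∈ range (b i), ∀ s ∈ range (b j),
      ((if (τ ^ (s + 1)) j = (τ ^ (r + 1)) i then 1 else 0) : ℤ) =
        ((if s = r then if i = j then 1 else 0 else 0) +
          if s = 0 then if r = b i - 1 then if (τ ^ (b i - 1)) i = j then 1 else 0 else 0 else 0) +
          if s = b j - 1 then if r = 0 then if (τ ^ (b j - 1)) j = i then 1 else 0 else 0 else 0 := by
    intro r hr s hs
    rw [mem_range] at hr hs
    -- the three summands stand for `s = r`, `s < r` and `r < s`
    rcases lt_trichotomy r s with h | h | h
    · rw [if_congr (aux i j hi hj r s h hs) rfl rfl, if_neg (show ¬ s = r by omega),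
        if_neg (show ¬ s = 0 by omega)]
      split_ifs <;> simp_all
    · subst h
      have : ((τ ^ (r + 1)) j = (τ ^ (r + 1)) i) ↔ i = j := by
        rw [Equiv.apply_eq_iff_eq, eq_comm]
      rw [if_congr this rfl rfl, if_pos rfl]
      split_ifs <;> omega
    · rw [if_congr (Iff.trans eq_comm (aux j i hj hi s r h hr)) rfl rfl, if_neg (show ¬ s = r by omega),
        if_neg (show ¬ r = 0 by omega)]
      split_ifs <;> simp_all
  rw [sum_congr rfl fun r hr => sum_congr rfl (pt r hr)]
  simp only [sum_add_distrib, sum_ite_eq', mem_range]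
  simp only [sum_ite_eq', mem_range, if_pos (show 0 < b j by omega),
    if_pos (show b j - 1 < b j by omega), if_pos (show b i - 1 < b i by omega),
    if_pos (show 0 < b i by omega)]
  congr 2
  by_cases hij : i = j
  · subst hij
    simp only [if_true]
    rw [sum_congr rfl fun r hr => if_pos (mem_range.1 hr)]
    simp
  · simp [hij]

variable [Fintype ι]

theorem sum_curveMatrix_mul (τ : Equiv.Perm ι) (b : ι → ℕ) (i : ι) (v : ι → ℤ) :
    ∑ l, curveMatrix τ b i l * v l = v i - ∑ r ∈ range (b i), v ((τ ^ (r + 1)) i) := by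
  simp only [curveMatrix, Matrix.of_apply, sub_mul, sum_sub_distrib, sum_mul]
  rw [sum_comm]
  simp

/-- If all points `τ i, …, τ^{b i} i` but the last two have rows with two terms only, the inner
products of the rows are those of a cycle of curves: a row meets exactly the row indexed by its last
point. -/
theorem curveMatrix_mul_transpose_apply (τ : Equiv.Perm ι) (b : ι → ℕ) (hpos : ∀ i, 1 ≤ b i)
    (hb : ∀ i x, 0 < x → x + 1 < b i → b ((τ ^ x) i) = 1) (i j : ι) :
    (curveMatrix τ b * (curveMatrix τ b).transpose) i j =
      (if i = j then (b i : ℤ) + 1 else 0) - (if (τ ^ b i) i = j then 1 else 0) -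
        if (τ ^ b j) j = i then 1 else 0 := by
  have expand : ∀ i j, (curveMatrix τ b * (curveMatrix τ b).transpose) i j =
      curveMatrix τ b j i - ∑ r ∈ range (b i), curveMatrix τ b j ((τ ^ (r + 1)) i) := fun i j => by
    rw [Matrix.mul_apply]
    exact sum_curveMatrix_mul τ b i (fun l => curveMatrix τ b j l)
  rcases (hpos i).eq_or_lt with hi | hi
  · rw [expand, gram_of_eq_one τ b i j hi.symm]
  rcases (hpos j).eq_or_lt with hj | hj
  · have : (curveMatrix τ b * (curveMatrix τ b).transpose) i j =
        (curveMatrix τ b * (curveMatrix τ b).transpose) j i := by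
      simp only [Matrix.mul_apply, Matrix.transpose_apply, mul_comm]
    rw [this, expand, gram_of_eq_one τ b j i hj.symm]
    by_cases hij : i = j
    · subst hij; ring
    · rw [if_neg hij, if_neg (Ne.symm hij)]; ring
  · rw [expand]
    simp only [curveMatrix, Matrix.of_apply, sum_sub_distrib]
    rw [sum_pow_apply_eq τ b hb i j hi hj, sum_sum_pow_apply_eq τ b hb i j hi hj]
    simp only [eq_comm (a := j) (b := (τ ^ _) i)]
    rw [sum_pow_apply_eq τ b hb j i hj hi]
    by_cases hij : i = j
    · subst hij; simp; ring
    · rw [if_neg hij, if_neg (Ne.symm hij), if_neg hij]; ring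

end Gram

/-! ### Allowed subsets and rotations of the circle -/

theorem IsGenerating.nonempty {N : ℕ} {A B : Finset (Fin N)} (h : IsGenerating A B) :
    B.Nonempty := by
  obtain ⟨-, ⟨a, -, rfl⟩ | ⟨k, -, rfl⟩⟩ := h <;> simp

theorem isAllowed_of_sdiff {N : ℕ} {A B G : Finset (Fin N)} (hB : B ≠ univ) (hG : IsGenerating A G)
    (hGB : G ⊆ B) (h : IsAllowed A (B \ G)) : IsAllowed A B := by
  obtain ⟨-, Q, hQ⟩ := h
  refine ⟨hB, Q.extend (b := G) hG.nonempty.ne_empty sdiff_disjoint (sdiff_union_of_subset hGB), ?_⟩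
  intro G' hG'
  rw [Finpartition.extend_parts, mem_insert] at hG'
  rcases hG' with rfl | hG'
  exacts [hG, hQ _ hG']

theorem IsAllowed.exists_part {N : ℕ} {A B : Finset (Fin N)} (h : IsAllowed A B) {j : Fin N}
    (hj : j ∈ B) : ∃ G, IsGenerating A G ∧ j ∈ G ∧ G ⊆ B ∧ IsAllowed A (B \ G) := by
  obtain ⟨hB, Q, hQ⟩ := h
  obtain ⟨G, hG, hjG⟩ := Q.exists_mem hj
  have hGB : G ⊆ B := Q.le hG
  refine ⟨G, hQ G hG, hjG, hGB, fun hu => ?_, Q.ofSubset (erase_subset G Q.parts) ?_, ?_⟩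
  · exact hB (univ_subset_iff.1 (hu ▸ sdiff_subset))
  · ext x
    simp only [mem_sup, mem_erase, id, mem_sdiff]
    constructor
    · rintro ⟨G', ⟨hne, hG'⟩, hx⟩
      exact ⟨Q.le hG' hx, fun hxG => hne (Q.eq_of_mem_parts hG' hG hx hxG)⟩
    · rintro ⟨hx, hxG⟩
      obtain ⟨G', hG', hx'⟩ := Q.exists_mem hx
      exact ⟨G', ⟨fun h => hxG (h ▸ hx'), hG'⟩, hx'⟩
  · intro G' hG'
    exact hQ G' (erase_subset _ _ hG')

/-- The first element of an arc of `B` can only be covered by a singleton if it lies in `A`. -/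
theorem isAllowed_iff_sdiff_singleton {N : ℕ} {A B : Finset (Fin N)} {i : Fin N} (hB : B ≠ univ)
    (hi : i ∉ B) (hj : finRotate N i ∈ B) (hjA : finRotate N i ∈ A) :
    IsAllowed A B ↔ IsAllowed A (B \ {finRotate N i}) := by
  have hsub : {finRotate N i} ⊆ B := singleton_subset_iff.2 hj
  constructor
  · intro h
    obtain ⟨G, hG, hjG, hGB, h'⟩ := h.exists_part hj
    obtain ⟨-, ⟨a, -, rfl⟩ | ⟨k, hk, rfl⟩⟩ := hG
    · rwa [mem_singleton.1 hjG]
    · rcases mem_insert.1 hjG with rfl | hjk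
      · exact absurd hjA hk
      · rw [mem_singleton, Equiv.apply_eq_iff_eq] at hjk
        subst hjk
        exact absurd (hGB (mem_insert_self _ _)) hi
  · refine isAllowed_of_sdiff hB ⟨?_, Or.inl ⟨_, hjA, rfl⟩⟩ hsub
    exact fun h => hB (univ_subset_iff.1 (h ▸ hsub))

theorem not_isAllowed_of_isolated {N : ℕ} {A B : Finset (Fin N)} {i : Fin N}
    (hi : i ∉ B) (hj : finRotate N i ∈ B) (hjA : finRotate N i ∉ A)
    (hl : finRotate N (finRotate N i) ∉ B) : ¬ IsAllowed A B := by
  intro h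
  obtain ⟨G, hG, hjG, hGB, h'⟩ := h.exists_part hj
  obtain ⟨-, ⟨a, ha, rfl⟩ | ⟨k, hk, rfl⟩⟩ := hG
  · rw [mem_singleton.1 hjG] at hjA
    exact hjA ha
  · rcases mem_insert.1 hjG with rfl | hjk
    · exact hl (hGB (by simp))
    · rw [mem_singleton, Equiv.apply_eq_iff_eq] at hjk
      subst hjk
      exact hi (hGB (mem_insert_self _ _))

/-- The first element of an arc of `B` can only be covered together with its successor if it does not
lie in `A`. -/
theorem isAllowed_iff_sdiff_pair {N : ℕ} {A B : Finset (Fin N)} {i : Fin N} (hB : B ≠ univ)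
    (hi : i ∉ B) (hj : finRotate N i ∈ B) (hjA : finRotate N i ∉ A)
    (hl : finRotate N (finRotate N i) ∈ B) :
    IsAllowed A B ↔ IsAllowed A (B \ {finRotate N i, finRotate N (finRotate N i)}) := by
  have hsub : {finRotate N i, finRotate N (finRotate N i)} ⊆ B := by
    exact insert_subset_iff.2 ⟨hj, singleton_subset_iff.2 hl⟩
  constructor
  · intro h
    obtain ⟨G, hG, hjG, hGB, h'⟩ := h.exists_part hj
    obtain ⟨-, ⟨a, ha, rfl⟩ | ⟨k, hk, rfl⟩⟩ := hG
    · rw [mem_singleton.1 hjG] at hjA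
      exact absurd ha hjA
    · rcases mem_insert.1 hjG with rfl | hjk
      · exact h'
      · rw [mem_singleton, Equiv.apply_eq_iff_eq] at hjk
        subst hjk
        exact absurd (hGB (mem_insert_self _ _)) hi
  · refine isAllowed_of_sdiff hB ⟨?_, Or.inr ⟨_, hjA, rfl⟩⟩ hsub
    exact fun h => hB (univ_subset_iff.1 (h ▸ hsub))

theorem isAllowed_empty {N : ℕ} (hN : 1 ≤ N) (A : Finset (Fin N)) : IsAllowed A ∅ := by
  have : NeZero N := ⟨by omega⟩
  exact ⟨(univ_nonempty (α := Fin N)).ne_empty.symm, Finpartition.empty _, by simp⟩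

theorem coe_finRotate_pow {n : ℕ} (r : ℕ) (i : Fin n) :
    (((finRotate n) ^ r) i : ℕ) = (i + r) % n := by
  induction r with
  | zero => simp [Nat.mod_eq_of_lt i.2]
  | succ r ih =>
    obtain ⟨m, rfl⟩ : ∃ m, n = m + 1 := ⟨n - 1, by have := i.2; omega⟩
    rw [pow_succ', Equiv.Perm.mul_apply, finRotate_apply, Fin.val_add, ih, Fin.val_one']
    simp [add_assoc]

theorem exists_finRotate_pow_apply_eq {n : ℕ} (i j : Fin n) : ∃ r, ((finRotate n) ^ r) i = j := by
  refine ⟨j + (n - i), Fin.ext ?_⟩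
  have := i.2
  rw [coe_finRotate_pow, show (i : ℕ) + (j + (n - i)) = j + n by omega, Nat.add_mod_right,
    Nat.mod_eq_of_lt j.2]

/-- A nonempty proper subset of the circle has an element whose predecessor is not in it. -/
theorem exists_notMem_finRotate_mem {N : ℕ} {B : Finset (Fin N)} (hB : B ≠ univ)
    (hne : B.Nonempty) : ∃ i, i ∉ B ∧ finRotate N i ∈ B := by
  by_contra! h
  obtain ⟨i, hi⟩ : ∃ i, i ∉ B := by
    by_contra! h'
    exact hB (eq_univ_of_forall h')
  obtain ⟨j, hj⟩ := hne
  obtain ⟨r, rfl⟩ := exists_finRotate_pow_apply_eq i j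
  have : ∀ r, ((finRotate N) ^ r) i ∉ B := fun r => by
    induction r with
    | zero => simpa
    | succ r ih => rw [pow_succ']; exact h _ ih
  exact this r hj

/-! ### The reduced determinant -/

/-- The index `j + 1` if `j ∈ A`, and `j + 2` otherwise, modulo `N`. -/
def skip {N : ℕ} (A : Finset (Fin N)) (j : Fin N) : Fin N :=
  if j ∈ A then finRotate N j else finRotate N (finRotate N j)

/-- The matrix whose determinant is the coefficient of `∏_{j ∉ B} k_j` in `det (reducedMatrix A k)`: its
row `j` is `e_{skip j} - e_j` if `j ∈ B`, and `e_{j+1}` otherwise. -/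
def coeffMatrix {N : ℕ} (A B : Finset (Fin N)) : Matrix (Fin N) (Fin N) ℤ :=
  Matrix.of fun j => if j ∈ B then Pi.single (skip A j) 1 - Pi.single j 1
    else Pi.single (finRotate N j) 1

theorem coeffMatrix_of_mem {N : ℕ} (A : Finset (Fin N)) {B : Finset (Fin N)} {j : Fin N}
    (hj : j ∈ B) : coeffMatrix A B j = Pi.single (skip A j) 1 - Pi.single j 1 := if_pos hj

theorem coeffMatrix_of_notMem {N : ℕ} (A : Finset (Fin N)) {B : Finset (Fin N)} {j : Fin N}
    (hj : j ∉ B) : coeffMatrix A B j = Pi.single (finRotate N j) 1 := if_neg hj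

theorem coeffMatrix_congr {N : ℕ} (A : Finset (Fin N)) {B B' : Finset (Fin N)} {j : Fin N}
    (h : j ∈ B ↔ j ∈ B') : coeffMatrix A B j = coeffMatrix A B' j :=
  if_congr h rfl rfl

/-- The matrix whose row `j` is `k_j e_{j+1} + e_{skip j} - e_j`. -/
def reducedMatrix {N : ℕ} (A : Finset (Fin N)) (k : Fin N → ℕ) : Matrix (Fin N) (Fin N) ℤ :=
  Matrix.of fun j =>
    (k j : ℤ) • Pi.single (finRotate N j) 1 + (Pi.single (skip A j) 1 - Pi.single j 1)

theorem det_reducedMatrix_eq_sum {N : ℕ} (A : Finset (Fin N)) (k : Fin N → ℕ) :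
    (reducedMatrix A k).det = ∑ B : Finset (Fin N), (∏ j ∈ Bᶜ, (k j : ℤ)) * (coeffMatrix A B).det := by
  have h := (Matrix.detRowAlternating (n := Fin N) (R := ℤ)).toMultilinearMap.map_add_univ
    (fun j => Pi.single (skip A j) 1 - Pi.single j 1)
    (fun j => (k j : ℤ) • Pi.single (finRotate N j) 1)
  have h0 : (reducedMatrix A k).det = (Matrix.detRowAlternating (n := Fin N) (R := ℤ)).toMultilinearMap
      ((fun j => Pi.single (skip A j) 1 - Pi.single j 1) +
        fun j => (k j : ℤ) • Pi.single (finRotate N j) 1) := by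
    rw [add_comm]; rfl
  rw [h0, h]
  refine sum_congr rfl fun B _ => ?_
  have h1 : B.piecewise (fun j => (Pi.single (skip A j) 1 - Pi.single j 1 : Fin N → ℤ))
      (fun j => (k j : ℤ) • Pi.single (finRotate N j) 1) =
      Bᶜ.piecewise (fun j => (k j : ℤ) • coeffMatrix A B j) (coeffMatrix A B) := by
    ext j l
    by_cases hj : j ∈ B <;> simp [hj, coeffMatrix, Finset.piecewise]
  rw [h1]
  exact MultilinearMap.map_piecewise_smul _ _ (fun j => coeffMatrix A B j) _

/-- The rows have sum zero. -/
theorem det_coeffMatrix_univ {N : ℕ} (hN : 1 ≤ N) (A : Finset (Fin N)) :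
    (coeffMatrix A univ).det = 0 := by
  refine Matrix.exists_mulVec_eq_zero_iff.1 ⟨fun _ => 1, ?_, ?_⟩
  · intro h
    simpa using congrFun h ⟨0, hN⟩
  · ext j
    simp [Matrix.mulVec, dotProduct, coeffMatrix, sum_sub_distrib]

/-- The row of the predecessor `i` is `e_{i+1}`; adding it to row `i + 1` leaves `e_{i+2}`. -/
theorem det_coeffMatrix_sdiff_singleton {N : ℕ} {A B : Finset (Fin N)} {i : Fin N}
    (hi : i ∉ B) (hj : finRotate N i ∈ B) (hjA : finRotate N i ∈ A) :
    (coeffMatrix A B).det = (coeffMatrix A (B \ {finRotate N i})).det := by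
  have hne : finRotate N i ≠ i := fun h => hi (h ▸ hj)
  rw [← Matrix.det_updateRow_add_self (coeffMatrix A B) hne]
  congr 1
  funext x
  rcases eq_or_ne x (finRotate N i) with rfl | hx
  · rw [Matrix.updateRow_self, coeffMatrix_of_mem A hj, coeffMatrix_of_notMem A hi,
      coeffMatrix_of_notMem A (by simp [-finRotate_apply]), skip, if_pos hjA, sub_add_cancel]
  · rw [Matrix.updateRow_ne hx]
    exact coeffMatrix_congr A (by simp [hx, -finRotate_apply])

/-- After adding row `i` to row `i + 1`, the rows `i + 1` and `i + 2` are both `e_{i+3}`. -/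
theorem det_coeffMatrix_of_isolated {N : ℕ} {A B : Finset (Fin N)} {i : Fin N}
    (hi : i ∉ B) (hj : finRotate N i ∈ B) (hjA : finRotate N i ∉ A)
    (hl : finRotate N (finRotate N i) ∉ B) : (coeffMatrix A B).det = 0 := by
  have hne : finRotate N i ≠ i := fun h => hi (h ▸ hj)
  have hne' : finRotate N i ≠ finRotate N (finRotate N i) := fun h => hl (h ▸ hj)
  rw [← Matrix.det_updateRow_add_self (coeffMatrix A B) hne]
  refine Matrix.det_zero_of_row_eq hne' ?_
  rw [Matrix.updateRow_self, Matrix.updateRow_ne hne'.symm, coeffMatrix_of_mem A hj,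
    coeffMatrix_of_notMem A hi, coeffMatrix_of_notMem A hl, skip, if_neg hjA, sub_add_cancel]

/-- Let `j = i + 1` and `l = i + 2`. Adding row `i` to row `j` leaves `e_{l+1}`; then column `l` is zero
outside row `l`, so that row `l` may be replaced by `-e_l`. Exchanging the rows `j` and `l` absorbs the
sign. -/
theorem det_coeffMatrix_sdiff_pair {N : ℕ} {A B : Finset (Fin N)} {i : Fin N}
    (hi : i ∉ B) (hj : finRotate N i ∈ B) (hjA : finRotate N i ∉ A)
    (hl : finRotate N (finRotate N i) ∈ B) :
    (coeffMatrix A B).det =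
      (coeffMatrix A (B \ {finRotate N i, finRotate N (finRotate N i)})).det := by
  set τ := finRotate N
  obtain ⟨j, hj_def⟩ : ∃ j, τ i = j := ⟨_, rfl⟩
  obtain ⟨l, hl_def⟩ : ∃ l, τ j = l := ⟨_, rfl⟩
  rw [hj_def, hl_def] at hl
  rw [hj_def] at hj hjA
  rw [hj_def, hl_def]
  have hji : j ≠ i := fun h => hi (h ▸ hj)
  have hli : l ≠ i := fun h => hi (h ▸ hl)
  have hlj : l ≠ j := fun h => hji (τ.injective (by rw [hl_def, h, hj_def]))
  have hτl : τ l ≠ l := fun h => hlj (τ.injective (by rw [h, hl_def]))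
  have hττl : τ (τ l) ≠ l := fun h =>
    hli (τ.injective (by rw [hj_def]; exact τ.injective (by rw [h, hl_def])))
  -- only `j` and its predecessor `i` could lead to `l`, and `i ∉ B`
  have hskip : ∀ x, x ∈ B → x ≠ j → skip A x ≠ l := by
    intro x hxB hxj h
    rw [skip] at h
    split_ifs at h
    · exact hxj (τ.injective (by rw [hl_def, ← h]))
    · have h' : τ x = j := τ.injective (by rw [hl_def, ← h])
      have h'' : x = i := τ.injective (by rw [h', hj_def])
      exact hi (h'' ▸ hxB)
  have hrow : coeffMatrix A B j + coeffMatrix A B i = Pi.single (τ l) 1 := by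
    rw [coeffMatrix_of_mem A hj, coeffMatrix_of_notMem A hi, skip, if_neg hjA, hj_def, hl_def,
      sub_add_cancel]
  rw [← Matrix.det_updateRow_add_self (coeffMatrix A B) hji, hrow]
  set C := (coeffMatrix A B).updateRow j (Pi.single (τ l) 1) with hC
  have hCl : C.updateRow l (Pi.single (skip A l) 1 + (-1 : ℤ) • Pi.single l 1) = C := by
    rw [show Pi.single (skip A l) (1 : ℤ) + (-1 : ℤ) • Pi.single l 1 = C l by
      rw [hC, Matrix.updateRow_ne hlj, coeffMatrix_of_mem A hl]; simp [sub_eq_add_neg]]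
    exact Matrix.updateRow_eq_self C l
  have hcol : (C.updateRow l (Pi.single (skip A l) 1)).det = 0 := by
    refine Matrix.det_eq_zero_of_column_eq_zero l fun x => ?_
    rcases eq_or_ne x l with rfl | hxl
    · rw [Matrix.updateRow_self, Pi.single_eq_of_ne (hskip x hl hlj).symm]
    rw [Matrix.updateRow_ne hxl]
    rcases eq_or_ne x j with rfl | hxj
    · rw [hC, Matrix.updateRow_self, Pi.single_eq_of_ne hτl.symm]
    rw [hC, Matrix.updateRow_ne hxj]
    by_cases hxB : x ∈ B
    · rw [coeffMatrix_of_mem A hxB, Pi.sub_apply, Pi.single_eq_of_ne (hskip x hxB hxj).symm,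
        Pi.single_eq_of_ne hxl.symm, sub_zero]
    · rw [coeffMatrix_of_notMem A hxB, Pi.single_eq_of_ne]
      exact fun h => hxj (τ.injective (by rw [hl_def, h]))
  have hswap : C.updateRow l (Pi.single l 1) =
      (coeffMatrix A (B \ {j, l})).submatrix (Equiv.swap j l) id := by
    funext x
    change _ = coeffMatrix A (B \ {j, l}) (Equiv.swap j l x)
    rcases eq_or_ne x l with rfl | hxl
    · rw [Matrix.updateRow_self, Equiv.swap_apply_right, coeffMatrix_of_notMem A (by simp)]
      exact hl_def ▸ rfl
    rw [Matrix.updateRow_ne hxl]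
    rcases eq_or_ne x j with rfl | hxj
    · rw [hC, Matrix.updateRow_self, Equiv.swap_apply_left, coeffMatrix_of_notMem A (by simp)]
    rw [hC, Matrix.updateRow_ne hxj, Equiv.swap_apply_of_ne_of_ne hxj hxl]
    exact coeffMatrix_congr A (by simp [hxj, hxl])
  rw [← hCl, Matrix.det_updateRow_add, hcol, Matrix.det_updateRow_smul, hswap, Matrix.det_permute,
    Equiv.Perm.sign_swap hlj.symm]
  simp

/-- The coefficients obey the recursion that decides whether a proper subset is allowed: strip the first
element of an arc of `B`, alone or with its successor. -/
theorem det_coeffMatrix {N : ℕ} (hN : 1 ≤ N) (A : Finset (Fin N)) [DecidablePred (IsAllowed A)]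
    (B : Finset (Fin N)) (hB : B ≠ univ) :
    (coeffMatrix A B).det = if IsAllowed A B then (coeffMatrix A ∅).det else 0 := by
  induction B using Finset.strongInduction with
  | H B ih =>
    rcases B.eq_empty_or_nonempty with rfl | hne
    · rw [if_pos (isAllowed_empty hN A)]
    obtain ⟨i, hi, hj⟩ := exists_notMem_finRotate_mem hB hne
    have lt : ∀ G : Finset (Fin N), finRotate N i ∈ G → B \ G ⊂ B := fun G hG =>
      ⟨sdiff_subset, fun h => (mem_sdiff.1 (h hj)).2 hG⟩
    have ne : ∀ G, B \ G ≠ univ := fun G h => hB (univ_subset_iff.1 (h ▸ sdiff_subset))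
    by_cases hjA : finRotate N i ∈ A
    · rw [det_coeffMatrix_sdiff_singleton hi hj hjA, ih _ (lt _ (by simp)) (ne _)]
      exact if_congr (isAllowed_iff_sdiff_singleton hB hi hj hjA).symm rfl rfl
    by_cases hl : finRotate N (finRotate N i) ∈ B
    · rw [det_coeffMatrix_sdiff_pair hi hj hjA hl, ih _ (lt _ (by simp)) (ne _)]
      exact if_congr (isAllowed_iff_sdiff_pair hB hi hj hjA hl).symm rfl rfl
    · rw [det_coeffMatrix_of_isolated hi hj hjA hl, if_neg (not_isAllowed_of_isolated hi hj hjA hl)]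

theorem det_coeffMatrix_empty_sq {N : ℕ} (A : Finset (Fin N)) :
    (coeffMatrix A ∅).det ^ 2 = 1 := by
  have : coeffMatrix A ∅ = (finRotate N).permMatrix ℤ := by
    ext x y
    simp [coeffMatrix, Equiv.Perm.permMatrix, PEquiv.toMatrix_apply, Pi.single_apply, eq_comm]
  rw [this, Matrix.det_permutation, ← Int.cast_pow, ← Units.val_pow_eq_pow_val, Int.units_sq]
  simp

theorem det_reducedMatrix_sq {N : ℕ} (hN : 1 ≤ N) (A : Finset (Fin N)) (k : Fin N → ℕ) :
    (reducedMatrix A k).det ^ 2 = (MvPolynomial.eval (fun j => (k j : ℤ)) (P A)) ^ 2 := by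
  classical
  have h : (reducedMatrix A k).det =
      (MvPolynomial.eval (fun j => (k j : ℤ)) (P A)) * (coeffMatrix A ∅).det := by
    rw [det_reducedMatrix_eq_sum, P, map_sum, sum_mul, sum_filter]
    refine sum_congr rfl fun B _ => ?_
    by_cases hB : B = univ
    · subst hB
      rw [det_coeffMatrix_univ hN, if_neg fun h => h.1 rfl, mul_zero]
    · rw [det_coeffMatrix hN A B hB]
      split_ifs <;> simp
  rw [h, mul_pow, det_coeffMatrix_empty_sq, mul_one]

/-! ### Elimination of the unmarked points -/

/-- `N` marked points `p j` on a cycle `τ`, the next marked point after `p j` being `τ^{g j} (p j)`. The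
path from `p j` has `b (p j) = k j + 1` steps, where `k j ≤ g j`; it goes beyond the next marked point
exactly if `j ∉ A`, and then by one step. The paths from unmarked points have one step. -/
structure IsNecklace {ι : Type*} {N : ℕ} (τ : Equiv.Perm ι) (b : ι → ℕ) (p : Fin N → ι)
    (A : Finset (Fin N)) (k g : Fin N → ℕ) : Prop where
  cyclic : ∀ x y, ∃ r : ℕ, (τ ^ r) x = y
  injective : Function.Injective p
  one_le : ∀ j, 1 ≤ k j
  apply_gap : ∀ j, (τ ^ g j) (p j) = p (finRotate N j)
  notMem : ∀ j r, 0 < r → r < g j → (τ ^ r) (p j) ∉ Set.range p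
  gap_eq : ∀ j, j ∉ A → g j = k j
  lt_gap : ∀ j, j ∈ A → k j < g j
  b_start : ∀ j, b (p j) = k j + 1
  b_eq_one : ∀ i, i ∉ Set.range p → b i = 1

namespace IsNecklace

variable {ι : Type*} {N : ℕ} {τ : Equiv.Perm ι} {b : ι → ℕ} {p : Fin N → ι}
    {A : Finset (Fin N)} {k g : Fin N → ℕ}

theorem le_gap (h : IsNecklace τ b p A k g) (j : Fin N) : k j ≤ g j := by
  by_cases hj : j ∈ A
  exacts [(h.lt_gap j hj).le, (h.gap_eq j hj).ge]

theorem b_pow_eq_one (h : IsNecklace τ b p A k g) (i : ι) (x : ℕ) (hx : 0 < x) (hxb : x + 1 < b i) :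
    b ((τ ^ x) i) = 1 := by
  by_cases hi : i ∈ Set.range p
  · obtain ⟨j, rfl⟩ := hi
    rw [h.b_start] at hxb
    exact h.b_eq_one _ (h.notMem j x hx (by have := h.le_gap j; omega))
  · rw [h.b_eq_one i hi] at hxb
    omega

theorem one_le_b (h : IsNecklace τ b p A k g) (i : ι) : 1 ≤ b i := by
  by_cases hi : i ∈ Set.range p
  · obtain ⟨j, rfl⟩ := hi
    rw [h.b_start]; omega
  · rw [h.b_eq_one i hi]

/-- `β i` is the index of the first marked point met from `i` on, `i` included, and `d i` is the number of
steps to it. -/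
theorem exists_next_dist (h : IsNecklace τ b p A k g) (hN : 1 ≤ N) :
    ∃ (β : ι → Fin N) (d : ι → ℕ), (∀ j, β (p j) = j) ∧
      (∀ i, i ∉ Set.range p → β i = β (τ i)) ∧ ∀ i, i ∉ Set.range p → d i = d (τ i) + 1 := by
  classical
  have ex : ∀ i, ∃ r : ℕ, (τ ^ r) i ∈ Set.range p := fun i => by
    obtain ⟨r, hr⟩ := h.cyclic i (p ⟨0, hN⟩)
    exact ⟨r, _, hr.symm⟩
  choose β hβ using fun i => Nat.find_spec (ex i)
  have hd : ∀ i, i ∉ Set.range p → Nat.find (ex i) = Nat.find (ex (τ i)) + 1 := fun i hi =>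
    Nat.find_comp_succ (ex i) (ex (τ i)) (by simpa using hi)
  refine ⟨β, fun i => Nat.find (ex i), fun j => h.injective ?_, fun i hi => h.injective ?_, hd⟩
  · have : Nat.find (ex (p j)) = 0 := (Nat.find_eq_zero _).2 ⟨j, rfl⟩
    rw [hβ, this]; rfl
  · rw [hβ, hβ, hd i hi, pow_succ]; rfl

theorem next_pow (h : IsNecklace τ b p A k g) {β : ι → Fin N} (hβp : ∀ j, β (p j) = j)
    (hβ : ∀ i, i ∉ Set.range p → β i = β (τ i)) (j : Fin N) (r : ℕ) (hr : 0 < r) (hrg : r ≤ g j) :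
    β ((τ ^ r) (p j)) = finRotate N j := by
  refine Nat.decreasingInduction' (P := fun s => β ((τ ^ s) (p j)) = finRotate N j)
    (fun s hs hrs ih => ?_) hrg ?_
  · rw [hβ _ (h.notMem j s (hr.trans_le hrs) hs), ← ih, pow_succ']; rfl
  · rw [h.apply_gap, hβp]

/-- The end of the path starting at `p j` is one step beyond `p (j + 1)` if `j ∉ A`, and not beyond it
otherwise. -/
theorem next_pow_succ (h : IsNecklace τ b p A k g) {β : ι → Fin N} (hβp : ∀ j, β (p j) = j)
    (hβ : ∀ i, i ∉ Set.range p → β i = β (τ i)) (j : Fin N) :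
    β ((τ ^ (k j + 1)) (p j)) = skip A j := by
  rw [skip]
  split_ifs with hj
  · exact h.next_pow hβp hβ j _ (by omega) (h.lt_gap j hj)
  · rw [← h.gap_eq j hj, add_comm, pow_add, Equiv.Perm.mul_apply, h.apply_gap]
    refine h.next_pow hβp hβ _ 1 one_pos ?_
    exact (h.one_le _).trans (h.le_gap _)

variable [Fintype ι] [DecidableEq ι]

/-- The rows of the unmarked points are `e_i - e_{τ i}`: triangular for the distance to the next marked
point. -/
theorem det_submatrix_unmarked (h : IsNecklace τ b p A k g) {d : ι → ℕ}
    (hd : ∀ i, i ∉ Set.range p → d i = d (τ i) + 1) :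
    ((curveMatrix τ b).submatrix (Subtype.val : {i // i ∉ Set.range p} → ι) Subtype.val).det = 1 := by
  set R := (curveMatrix τ b).submatrix (Subtype.val : {i // i ∉ Set.range p} → ι) Subtype.val with hR
  have hval : ∀ x y, R x y = (if x = y then 1 else 0) - if τ x = y then 1 else 0 := fun x y => by
    rw [hR, Matrix.submatrix_apply, curveMatrix, Matrix.of_apply, h.b_eq_one x x.2, sum_range_one]
    simp [Subtype.ext_iff]
  have hoff : ∀ x y, x ≠ y → R x y ≠ 0 → d x = d y + 1 := fun x y hxy hne => by
    rw [hval, if_neg hxy] at hne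
    by_cases hτ : τ x = y
    · rw [hd x x.2, hτ]
    · simp [hτ] at hne
  have hdiag : ∀ x, R x x = 1 := fun x => by
    rw [hval, if_pos rfl, if_neg, sub_zero]
    intro hx
    have := hd x x.2
    rw [hx] at this
    omega
  have htri : R.transpose.BlockTriangular fun x => d x := fun x y hxy => by
    by_contra hne
    have := hoff y x (by rintro rfl; exact lt_irrefl _ hxy) hne
    dsimp only at hxy
    omega
  rw [← Matrix.det_transpose, htri.det]
  refine prod_eq_one fun a _ => ?_
  have : R.transpose.toSquareBlock (fun x => d x) a = 1 := by
    ext ⟨x, hx⟩ ⟨y, hy⟩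
    rcases eq_or_ne x y with rfl | hxy
    · rw [Matrix.one_apply_eq]
      exact hdiag x
    · rw [Matrix.one_apply_ne (fun h => hxy (congrArg Subtype.val h))]
      by_contra hne
      have := hoff y x hxy.symm hne
      change d x = a at hx
      change d y = a at hy
      omega
  rw [this, Matrix.det_one]

/-- The vectors orthogonal to the rows of the unmarked points are constant on each set of points with the
same next marked point. Adding columns accordingly makes the matrix block triangular, the block of the
marked points being `-reducedMatrix A k`. -/
theorem det_curveMatrix (h : IsNecklace τ b p A k g) (hN : 1 ≤ N) :
    (curveMatrix τ b).det = (-reducedMatrix A k).det := by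
  obtain ⟨β, d, hβp, hβ, hd⟩ := h.exists_next_dist hN
  have hR := h.det_submatrix_unmarked hd
  let e : Fin N ⊕ {i // i ∉ Set.range p} ≃ ι :=
    ((Equiv.ofInjective p h.injective).sumCongr (Equiv.refl _)).trans
      (Equiv.sumCompl fun i => i ∈ Set.range p)
  set C := curveMatrix τ b with hC
  let W : Matrix ι (Fin N) ℤ := Matrix.of fun i l => if β i = l then 1 else 0
  have hsum : ∀ i l, (C * W) i l = W i l - ∑ r ∈ range (b i), W ((τ ^ (r + 1)) i) l := fun i l => by
    rw [Matrix.mul_apply]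
    exact sum_curveMatrix_mul τ b i fun i => W i l
  have hlow : ∀ i, i ∉ Set.range p → ∀ l, (C * W) i l = 0 := fun i hi l => by
    rw [hsum, h.b_eq_one i hi, sum_range_one]
    simp [W, hβ i hi]
  have hup : ∀ j l, (C * W) (p j) l = (-reducedMatrix A k) j l := fun j l => by
    rw [hsum, h.b_start, sum_range_succ]
    have : ∀ r ∈ range (k j), W ((τ ^ (r + 1)) (p j)) l = if finRotate N j = l then 1 else 0 :=
      fun r hr => by
        rw [mem_range] at hr
        simp only [W, Matrix.of_apply]
        rw [h.next_pow hβp hβ j (r + 1) (by omega) (by have := h.le_gap j; omega)]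
    rw [sum_congr rfl this]
    simp only [W, Matrix.of_apply, hβp, h.next_pow_succ hβp hβ, reducedMatrix, Matrix.neg_apply,
      Pi.add_apply, Pi.sub_apply, Pi.smul_apply, Pi.single_apply, eq_comm (a := l), sum_const,
      card_range, smul_eq_mul, nsmul_eq_mul]
    ring
  let F : Matrix (Fin N ⊕ {i // i ∉ Set.range p}) (Fin N ⊕ {i // i ∉ Set.range p}) ℤ :=
    Matrix.fromBlocks 1 0 (W.submatrix Subtype.val id) 1
  have hF : F.det = 1 := by rw [Matrix.det_fromBlocks_zero₁₂]; simp
  have hFW : ∀ y l, F y (Sum.inl l) = W (e y) l := by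
    rintro (j | i) l
    · change (1 : Matrix (Fin N) (Fin N) ℤ) j l = if β (p j) = l then 1 else 0
      rw [hβp, Matrix.one_apply]
    · rfl
  have hmul : C.submatrix e e * F = Matrix.fromBlocks (-reducedMatrix A k)
      (C.submatrix p Subtype.val) 0 (C.submatrix Subtype.val Subtype.val) := by
    have hl : ∀ x l, (C.submatrix e e * F) x (Sum.inl l) = (C * W) (e x) l := fun x l => by
      simp only [Matrix.mul_apply, hFW, Matrix.submatrix_apply]
      exact Equiv.sum_comp e fun y => C (e x) y * W y l
    have hr : ∀ x i, (C.submatrix e e * F) x (Sum.inr i) = C (e x) i := fun x i => by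
      rw [Matrix.mul_apply, Fintype.sum_sum_type]
      simp [F, Matrix.one_apply, e]
    ext x (l | i)
    · rw [hl]
      rcases x with j | i
      · exact hup j l
      · exact hlow i i.2 l
    · rw [hr]
      rcases x with j | j <;> rfl
  rw [← Matrix.det_submatrix_equiv_self e C, ← mul_one (C.submatrix e e).det, ← hF, ← Matrix.det_mul,
    hmul, Matrix.det_fromBlocks_zero₂₁, hR, mul_one]

theorem det_gram (h : IsNecklace τ b p A k g) (hN : 1 ≤ N) :
    (curveMatrix τ b * (curveMatrix τ b).transpose).det =
      (MvPolynomial.eval (fun j => (k j : ℤ)) (P A)) ^ 2 := by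
  rw [Matrix.det_mul, Matrix.det_transpose, h.det_curveMatrix hN, ← sq, Matrix.det_neg, mul_pow,
    det_reducedMatrix_sq hN, ← pow_mul, mul_comm (Fintype.card _), pow_mul]
  simp

end IsNecklace

/-! ### Intersection matrices and cyclic successors -/

theorem meets_iff (a : List ℕ) (i j : Fin a.length) (hi : 1 ≤ a.get i) :
    Meets a i j ↔ ((finRotate a.length) ^ (a.get i - 1)) i = j := by
  rw [Fin.ext_iff, coe_finRotate_pow, Meets,
    show (i : ℕ) + a.get i = i + (a.get i - 1) + 1 by omega]
  constructor
  · intro h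
    have h' := Nat.ModEq.add_right_cancel' 1 h
    rwa [Nat.ModEq, Nat.mod_eq_of_lt j.2] at h'
  · intro h
    refine Nat.ModEq.add_right 1 ?_
    rw [Nat.ModEq, h, Nat.mod_eq_of_lt j.2]

/-- The matrix of the sequence is a Gram matrix, at the price of the condition that after an entry
`a_i ≥ 4` the next `a_i - 3` entries are `2`. -/
theorem intersectionMatrix_eq (a : List ℕ) (h2 : ∀ i, 2 ≤ a.get i)
    (hb : ∀ i x, 0 < x → x + 1 < a.get i - 1 →
      a.get (((finRotate a.length) ^ x) i) - 1 = 1) :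
    intersectionMatrix a = curveMatrix (finRotate a.length) (fun i => a.get i - 1) *
      (curveMatrix (finRotate a.length) fun i => a.get i - 1).transpose := by
  ext i j
  rw [curveMatrix_mul_transpose_apply _ _ (fun i => by have := h2 i; omega) hb]
  rw [intersectionMatrix, Matrix.of_apply]
  have h1 : ∀ i, 1 ≤ a.get i := fun i => one_le_two.trans (h2 i)
  simp only [← meets_iff a _ _ (h1 _)]
  have hcast : ((a.get i - 1 : ℕ) : ℤ) + 1 = a.get i := by have := h1 i; omega
  rw [hcast]
  by_cases hij : i = j
  · subst hij
    by_cases hm : Meets a i i <;> simp only [hm, if_true, if_false] <;> ring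
  · by_cases hm : Meets a i j <;> by_cases hm' : Meets a j i <;> simp [hij, hm, hm']

theorem coe_finRotate_eq_ite {n : ℕ} (i : Fin n) :
    (finRotate n i : ℕ) = if (i : ℕ) + 1 = n then 0 else (i : ℕ) + 1 := by
  have h := coe_finRotate_pow 1 i
  rw [pow_one] at h
  rw [h]
  have := i.2
  split_ifs with hi
  · rw [hi, Nat.mod_self]
  · exact Nat.mod_eq_of_lt (by omega)

/-- A marked place cyclically adjacent to the marked place `pos j` is the next one. -/
theorem eq_finRotate_of_finRotate_eq {N L : ℕ} {pos : Fin N → Fin L} (hpos : StrictMono pos)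
    {j j' : Fin N} (h : finRotate L (pos j) = pos j') : j' = finRotate N j := by
  have hv := congrArg Fin.val h
  rw [coe_finRotate_eq_ite] at hv
  ext
  rw [coe_finRotate_eq_ite]
  have hj := j.2
  have hj' := j'.2
  have hle : ∀ x y : Fin N, (pos x : ℕ) ≤ pos y ↔ (x : ℕ) ≤ y := fun x y => hpos.le_iff_le
  have h1 := hle j j'
  have h2 := hle j' j
  have hL := (pos j).2
  split_ifs with hN
  · have h3 := hle j' ⟨0, by omega⟩
    dsimp only at h3
    split_ifs at hv <;> omega
  · have h3 := hle j' ⟨j + 1, by omega⟩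
    have h4 := hle ⟨j + 1, by omega⟩ j
    have h5 := (pos ⟨j + 1, by omega⟩).2
    dsimp only at h3 h4
    split_ifs at hv <;> omega

/-- A marked place separated from `pos j` by a single unmarked one is the next one. -/
theorem eq_finRotate_of_finRotate_finRotate_eq {N L : ℕ} {pos : Fin N → Fin L}
    (hpos : StrictMono pos) {j j' : Fin N} (hn : finRotate L (pos j) ∉ Set.range pos)
    (h : finRotate L (finRotate L (pos j)) = pos j') : j' = finRotate N j := by
  have hv := congrArg Fin.val h
  have hn' : ∀ l, (pos l : ℕ) ≠ finRotate L (pos j) := fun l e => hn ⟨l, Fin.ext e⟩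
  rw [coe_finRotate_eq_ite (finRotate L _)] at hv
  simp only [coe_finRotate_eq_ite] at hv hn'
  ext
  rw [coe_finRotate_eq_ite]
  have hj := j.2
  have hj' := j'.2
  have hle : ∀ x y : Fin N, (pos x : ℕ) ≤ pos y ↔ (x : ℕ) ≤ y := fun x y => hpos.le_iff_le
  have h1 := hle j j'
  have h2 := hle j' j
  have hL := (pos j).2
  split_ifs with hN
  · have h3 := hle j' ⟨0, by omega⟩
    have h4 := hn' ⟨0, by omega⟩
    dsimp only at h3
    split_ifs at hv h4 <;> omega
  · have h3 := hle j' ⟨j + 1, by omega⟩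
    have h4 := hle ⟨j + 1, by omega⟩ j
    have h5 := (pos ⟨j + 1, by omega⟩).2
    have h6 := hn' ⟨j + 1, by omega⟩
    dsimp only at h3 h4
    split_ifs at hv h6 <;> omega

/-! ### Terms of a concatenation of blocks -/

section Offset
variable {L : ℕ} (σ : Fin L → Block)

/-- The number of terms of the first `t` blocks. -/
def offset (t : ℕ) : ℕ :=
  (((List.ofFn σ).take t).flatMap Block.toList).length

theorem offset_zero : offset σ 0 = 0 := rfl

theorem offset_length : offset σ L = (concat σ).length := by
  rw [offset, List.take_of_length_le (by simp), concat]

theorem offset_succ (t : Fin L) : offset σ (t + 1) = offset σ t + (σ t).toList.length := by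
  rw [offset, List.take_succ_eq_append_getElem (by simp), List.flatMap_append]
  simp [offset]

theorem offset_mono : Monotone (offset σ) := by
  refine monotone_nat_of_le_succ fun t => ?_
  by_cases ht : t < L
  · rw [offset_succ σ ⟨t, ht⟩]
    exact Nat.le_add_right _ _
  · rw [offset, offset, List.take_of_length_le (by simp; omega),
      List.take_of_length_le (by simp; omega)]

theorem getElem?_concat (t : Fin L) (r : ℕ) (hr : r < (σ t).toList.length) :
    (concat σ)[offset σ t + r]? = some (σ t).toList[r] := by
  have h : List.ofFn σ = (List.ofFn σ).take t ++ σ t :: (List.ofFn σ).drop (t + 1) := by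
    conv_lhs => rw [← List.take_append_drop t (List.ofFn σ)]
    rw [List.drop_eq_getElem_cons (by simp)]
    simp
  rw [concat, h, List.flatMap_append, List.flatMap_cons, List.getElem?_append_right (by simp [offset]),
    show offset σ t + r - _ = r by simp [offset], List.getElem?_append_left hr,
    List.getElem?_eq_getElem hr]

theorem offset_add_lt (t : Fin L) (r : ℕ) (hr : r < (σ t).toList.length) :
    offset σ t + r < (concat σ).length :=
  (List.getElem?_eq_some_iff.1 (getElem?_concat σ t r hr)).1

theorem exists_offset_add (x : ℕ) (hx : x < (concat σ).length) :
    ∃ (t : Fin L) (r : ℕ), r < (σ t).toList.length ∧ x = offset σ t + r := by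
  have : ∀ s, s ≤ L → x < offset σ s →
      ∃ (t : Fin L) (r : ℕ), r < (σ t).toList.length ∧ x = offset σ t + r := by
    intro s
    induction s with
    | zero => intro _ h; rw [offset_zero] at h; omega
    | succ s ih =>
      intro hs h
      by_cases hlt : x < offset σ s
      · exact ih (by omega) hlt
      · have := offset_succ σ ⟨s, hs⟩
        dsimp only at this
        exact ⟨⟨s, hs⟩, x - offset σ s, by omega, by dsimp only; omega⟩
  exact this L le_rfl (by rwa [offset_length])

variable (hσ : ∀ t, 0 < (σ t).toList.length)

/-- The index of the first term of block `t`. -/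
def start (t : Fin L) : Fin (concat σ).length :=
  ⟨offset σ t, offset_add_lt σ t 0 (hσ t)⟩

theorem start_injective : Function.Injective (start σ hσ) := by
  have key : ∀ t t' : Fin L, t < t' → offset σ t < offset σ t' := fun t t' h => by
    have h1 := offset_succ σ t
    have h2 := offset_mono σ (show (t : ℕ) + 1 ≤ t' from h)
    have := hσ t
    omega
  intro t t' h
  have h' : offset σ t = offset σ t' := congrArg Fin.val h
  rcases lt_trichotomy t t' with hlt | rfl | hlt
  · exact absurd h' (key _ _ hlt).ne
  · rfl
  · exact absurd h' (key _ _ hlt).ne'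

theorem coe_pow_start (t : Fin L) (r : ℕ) (hr : r < (σ t).toList.length) :
    (((finRotate (concat σ).length) ^ r) (start σ hσ t) : ℕ) = offset σ t + r := by
  rw [coe_finRotate_pow]
  exact Nat.mod_eq_of_lt (offset_add_lt σ t r hr)

theorem get_pow_start (t : Fin L) (r : ℕ) (hr : r < (σ t).toList.length) :
    (concat σ).get (((finRotate (concat σ).length) ^ r) (start σ hσ t)) = (σ t).toList[r] := by
  have h := getElem?_concat σ t r hr
  rw [← coe_pow_start σ hσ t r hr, List.getElem?_eq_getElem (Fin.is_lt _)] at h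
  exact Option.some.inj h

theorem pow_length_start (t : Fin L) :
    ((finRotate (concat σ).length) ^ (σ t).toList.length) (start σ hσ t) =
      start σ hσ (finRotate L t) := by
  ext
  rw [coe_finRotate_pow]
  change (offset σ t + _) % _ = offset σ (finRotate L t)
  rw [← offset_succ, coe_finRotate_eq_ite]
  split_ifs with h
  · rw [h, offset_length, Nat.mod_self, offset_zero]
  · have ht : (t : ℕ) + 1 < L := by omega
    exact Nat.mod_eq_of_lt (start σ hσ ⟨t + 1, ht⟩).2

end Offset

/-! ### Decompositions into singular and regular blocks -/

theorem getElem_regular (m r : ℕ) (hr : r < (Block.regular m).toList.length) :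
    (Block.regular m).toList[r] = 2 := by
  simp [Block.toList]

theorem getElem_singular (k r : ℕ) (hr : r < (Block.singular k).toList.length) :
    (Block.singular k).toList[r] = if r = 0 then k + 2 else 2 := by
  cases r <;> simp [Block.toList]

theorem length_singular (k : ℕ) (hk : 1 ≤ k) : (Block.singular k).toList.length = k := by
  simp [Block.toList]; omega

theorem length_regular (m : ℕ) : (Block.regular m).toList.length = m := by
  simp [Block.toList]

namespace IsDecomposition

variable {N L : ℕ} {σ : Fin L → Block} {pos : Fin N → Fin L} {k : Fin N → ℕ}

theorem isRegular_iff (h : IsDecomposition σ pos k) (t : Fin L) :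
    (σ t).IsRegular ↔ t ∉ Set.range pos := by
  constructor
  · rintro ht ⟨j, rfl⟩
    rw [h.singular] at ht
    exact ht
  · intro ht
    obtain ⟨m, -, hm⟩ := h.regular t ht
    rw [hm]
    trivial

theorem followSet_eq (h : IsDecomposition σ pos k) [DecidablePred (· ∈ Set.range pos)] :
    followSet σ pos = univ.filter fun j => finRotate L (pos j) ∉ Set.range pos := by
  ext j
  simp [followSet, h.isRegular_iff, -finRotate_apply]

theorem length_pos (h : IsDecomposition σ pos k) (t : Fin L) : 0 < (σ t).toList.length := by
  by_cases ht : t ∈ Set.range pos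
  · obtain ⟨j, rfl⟩ := ht
    rw [h.singular, length_singular _ (h.one_le j)]
    exact h.one_le j
  · obtain ⟨m, hm, e⟩ := h.regular t ht
    rw [e, length_regular]
    exact hm

theorem length_pos_eq (h : IsDecomposition σ pos k) (j : Fin N) :
    (σ (pos j)).toList.length = k j := by
  rw [h.singular, length_singular _ (h.one_le j)]

theorem get_start (h : IsDecomposition σ pos k) (j : Fin N) :
    (concat σ).get (start σ h.length_pos (pos j)) = k j + 2 := by
  have := get_pow_start σ h.length_pos (pos j) 0 (h.length_pos _)
  simp only [h.singular, getElem_singular, if_true] at this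
  exact this

theorem get_pow_start_pos (h : IsDecomposition σ pos k) (j : Fin N) (r : ℕ) (hr : 0 < r)
    (hrk : r < k j) :
    (concat σ).get (((finRotate (concat σ).length) ^ r) (start σ h.length_pos (pos j))) = 2 := by
  rw [get_pow_start σ h.length_pos (pos j) r (by rwa [h.length_pos_eq])]
  simp only [h.singular, getElem_singular, if_neg hr.ne']

theorem get_pow_start_regular (h : IsDecomposition σ pos k) (t : Fin L) (ht : t ∉ Set.range pos)
    (r : ℕ) (hr : r < (σ t).toList.length) :
    (concat σ).get (((finRotate (concat σ).length) ^ r) (start σ h.length_pos t)) = 2 := by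
  rw [get_pow_start σ h.length_pos t r hr]
  obtain ⟨m, -, e⟩ := h.regular t ht
  simp only [e, getElem_regular]

/-- The first terms of the singular blocks are exactly the terms different from `2`. -/
theorem mem_range_start_iff (h : IsDecomposition σ pos k) (i : Fin (concat σ).length) :
    i ∈ Set.range (fun j => start σ h.length_pos (pos j)) ↔ (concat σ).get i ≠ 2 := by
  constructor
  · rintro ⟨j, rfl⟩
    have := h.one_le j
    rw [h.get_start]
    omega
  · intro hi
    obtain ⟨t, r, hr, e⟩ := exists_offset_add σ i i.2
    have hi' : i = ((finRotate (concat σ).length) ^ r) (start σ h.length_pos t) :=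
      Fin.ext (by rw [coe_pow_start σ h.length_pos t r hr, e])
    subst hi'
    by_cases ht : t ∈ Set.range pos
    · obtain ⟨j, rfl⟩ := ht
      rcases Nat.eq_zero_or_pos r with rfl | hr0
      · exact ⟨j, rfl⟩
      · rw [h.length_pos_eq] at hr
        exact absurd (h.get_pow_start_pos j r hr0 hr) hi
    · exact absurd (h.get_pow_start_regular t ht r hr) hi

theorem isNecklace (h : IsDecomposition σ pos k) [DecidablePred (· ∈ Set.range pos)] :
    IsNecklace (finRotate (concat σ).length) (fun i => (concat σ).get i - 1)
      (fun j => start σ h.length_pos (pos j)) (followSet σ pos) k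
      (fun j => if finRotate L (pos j) ∈ Set.range pos then k j
        else k j + (σ (finRotate L (pos j))).toList.length) := by
  have hk : ∀ j, ((finRotate (concat σ).length) ^ k j) (start σ h.length_pos (pos j)) =
      start σ h.length_pos (finRotate L (pos j)) := fun j => by
    conv_lhs => rw [← h.length_pos_eq j]
    exact pow_length_start σ h.length_pos (pos j)
  refine ⟨exists_finRotate_pow_apply_eq,
    fun j j' e => h.strictMono.injective (start_injective σ h.length_pos e), h.one_le, ?_, ?_, ?_, ?_,
    ?_, ?_⟩
  · intro j
    split_ifs with hj
    · obtain ⟨j', hj'⟩ := hj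
      rw [hk, ← hj', eq_finRotate_of_finRotate_eq h.strictMono hj'.symm]
    · have hreg := (h.isRegular_iff _).2 hj
      have hnn := h.not_adjacent _ hreg
      rw [h.isRegular_iff, not_not] at hnn
      obtain ⟨j', hj'⟩ := hnn
      rw [add_comm, pow_add, Equiv.Perm.mul_apply, hk, pow_length_start, ← hj',
        eq_finRotate_of_finRotate_finRotate_eq h.strictMono hj hj'.symm]
  · intro j r hr hrg
    rw [h.mem_range_start_iff, not_not]
    rcases lt_or_ge r (k j) with hlt | hge
    · exact h.get_pow_start_pos j r hr hlt
    · split_ifs at hrg with hj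
      · omega
      · obtain ⟨s, rfl⟩ := Nat.exists_eq_add_of_le' hge
        rw [pow_add, Equiv.Perm.mul_apply, hk]
        exact h.get_pow_start_regular _ hj s (by omega)
  · intro j hj
    rw [h.followSet_eq, mem_filter, not_and, not_not] at hj
    exact if_pos (hj (mem_univ _))
  · intro j hj
    rw [h.followSet_eq, mem_filter] at hj
    rw [if_neg hj.2]
    have := h.length_pos (finRotate L (pos j))
    omega
  · intro j
    have := h.get_start j
    omega
  · intro i hi
    rw [h.mem_range_start_iff, not_not] at hi
    omega

theorem two_le_get (h : IsDecomposition σ pos k) (i : Fin (concat σ).length) :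
    2 ≤ (concat σ).get i := by
  by_cases hi : (concat σ).get i = 2
  · exact hi.ge
  · obtain ⟨j, rfl⟩ := (h.mem_range_start_iff i).2 hi
    rw [h.get_start]
    omega

theorem det_M (h : IsDecomposition σ pos k) (hN : 1 ≤ N) :
    (M σ).det = (MvPolynomial.eval (fun j => (k j : ℤ)) (P (followSet σ pos))) ^ 2 := by
  classical
  have hn := h.isNecklace
  rw [M, intersectionMatrix_eq _ h.two_le_get hn.b_pow_eq_one, hn.det_gram hN]

end IsDecomposition

end GSS

theorem mainTheorem1 (N ρ : ℕ) (hN : 1 ≤ N) (hρ : ρ ≤ N) (σ : Fin (N + ρ) → GSS.Block)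
    (pos : Fin N → Fin (N + ρ)) (k : Fin N → ℕ) (hσ : GSS.IsDecomposition σ pos k) :
    (GSS.M σ).det =
        (MvPolynomial.eval (fun j => (k j : ℤ)) (GSS.P (GSS.followSet σ pos))) ^ 2 ∧
      ∀ σ' : Fin (N + ρ) → GSS.Block, GSS.IsDecomposition σ' pos k →
        (GSS.M σ').det = (GSS.M σ).det := by
  classical
  refine ⟨hσ.det_M hN, fun σ' hσ' => ?_⟩
  rw [hσ.det_M hN, hσ'.det_M hN, hσ.followSet_eq, hσ'.followSet_eq]
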